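/- Notation. Let $\mathfrak H=\{z=x+iy: y>0\}$, $q=e^{2\pi i z}$ and $\mathbb L=\log|q|=-2\pi y$. For integers $r,s$ let $\mathcal M_{r,s}$ be the complex vector space of real analytic functions $f:\mathfrak H\to\mathbb C$ such that $$f(\gamma z)=(cz+d)^r(c\bar z+d)^s f(z)\qquad\text{for all }\gamma=\begin{pmatrix}a&b\\c&d\end{pmatrix}\in \mathrm{SL}_2(\mathbb Z),$$ and which admit an expansion at the cusp in $\mathbb C[[q,\bar q]][\mathbb L^{\pm 1}]$, i.e. for some $N\in\mathbb N$ and $a^{(k)}_{m,n}\in\mathbb C$ $$f=\sum_{k=-N}^{N}\mathbb L^k\sum_{m,n\ge 0}a^{(k)}_{m,n}\,q^m\bar q^n ,$$ where the inner series converge absolutely and the equality holds for all $z$ with $\mathrm{Im}(z)$ sufficiently large. Put $\mathcal M=\bigoplus_{r,s}\mathcal M_{r,s}$, and let $\partial$ be the operator of bidegree $(1,-1)$ on $\mathcal M$ which acts on $\mathcal M_{p,q}$ by $\partial_p=(z-\bar z)\frac{\partial}{\partial z}+p$. Let $S_k$ be the space of holomorphic cusp forms of weight $k$ for $\mathrm{SL}_2(\mathbb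 Z)$, and let $\mathcal D=\{z\in\mathfrak H: |z|>1,\ |\mathrm{Re}(z)|<\tfrac12\}$. For $f\in\mathcal M_{r,s}$ and $g\in S_{r-s}$ let $$\langle f,g\rangle=\int_{\mathcal D} f(z)\,\overline{g(z)}\;y^{r}\,\frac{dx\,dy}{y^2}.$$ The holomorphic projection $p^h:\mathcal M_{r,s}\to S_{r-s}$ is the linear map determined by $\langle p^h(f),g\rangle=\langle f,g\rangle$ for all $g\in S_{r-s}$, where the left-hand side is the classical Petersson inner product $\int_{\mathcal D}p^h(f)\,\overline g\,y^{r-s}\,\frac{dx\,dy}{y^2}$. Theorem. Let $r,s\in\mathbb Z$ and $f\in\mathcal M_{r,s}$. If there exists $F\in\mathcal M$ with $\partial F=f$, then for every holomorphic cusp form $g\in S_{r-s}$ the integral $\langle f,g\rangle$ converges absolutely and $$\langle f,g\rangle=0 .$$ In particular $p^h(f)=0$. -/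

import Mathlib

open UpperHalfPlane MeasureTheory
open scoped Modular MatrixGroups ComplexConjugate DirectSum

noncomputable section

namespace RealAnalyticModular

/-- The nome `q = exp (2 π i z)`. -/
def nome (z : ℍ) : ℂ := Complex.exp (2 * Real.pi * Complex.I * z)

/-- The function `𝕃 = log |q| = i π (z - conj z) = - 2 π y`. -/
def LL (z : ℍ) : ℂ := ((-2 * Real.pi * z.im : ℝ) : ℂ)

/-- `f` is real analytic on the upper half plane. -/
def IsRealAnalytic (f : ℍ → ℂ) : Prop :=
  AnalyticOnNhd ℝ (fun w : ℂ => f (ofComplex w)) {w : ℂ | 0 < w.im}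

/-- `f` is modular of weights `(r, s)`:
`f (γ z) = (c z + d) ^ r * (c (conj z) + d) ^ s * f z` for all `γ = (a, b; c, d)` in `SL(2, ℤ)`. -/
def IsModular (r s : ℤ) (f : ℍ → ℂ) : Prop :=
  ∀ (γ : SL(2, ℤ)) (z : ℍ),
    f (γ • z) =
      ((γ 1 0 : ℂ) * z + (γ 1 1 : ℂ)) ^ r * ((γ 1 0 : ℂ) * conj (z : ℂ) + (γ 1 1 : ℂ)) ^ s * f z

/-- `f` admits an expansion at the cusp in `ℂ[[q, conj q]][𝕃, 𝕃⁻¹]`: there are finitely many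
power series `∑ a k (m, n) q ^ m (conj q) ^ n`, indexed by integers `k`, which converge
(absolutely) in a neighbourhood of the cusp, and there
`f = ∑ k, 𝕃 ^ k ∑ (m, n), a k (m, n) q ^ m (conj q) ^ n`. -/
def HasCuspExpansion (f : ℍ → ℂ) : Prop :=
  ∃ (a : ℤ →₀ (ℕ × ℕ → ℂ)) (Y : ℝ), ∀ z : ℍ, Y < z.im →
    (∀ k, Summable fun p : ℕ × ℕ => a k p * nome z ^ p.1 * conj (nome z) ^ p.2) ∧
    f z = ∑ k ∈ a.support, LL z ^ k * ∑' p : ℕ × ℕ, a k p * nome z ^ p.1 * conj (nome z) ^ p.2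

lemma HasCuspExpansion.add {f g : ℍ → ℂ} (hf : HasCuspExpansion f) (hg : HasCuspExpansion g) :
    HasCuspExpansion (f + g) := by
  obtain ⟨a, Y, ha⟩ := hf
  obtain ⟨b, Z, hb⟩ := hg
  refine ⟨a + b, max Y Z, fun z hz => ?_⟩
  obtain ⟨ha1, ha2⟩ := ha z (lt_of_le_of_lt (le_max_left _ _) hz)
  obtain ⟨hb1, hb2⟩ := hb z (lt_of_le_of_lt (le_max_right _ _) hz)
  have key : ∀ k, (fun p : ℕ × ℕ => (a + b) k p * nome z ^ p.1 * conj (nome z) ^ p.2) =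
      fun p => a k p * nome z ^ p.1 * conj (nome z) ^ p.2 +
        b k p * nome z ^ p.1 * conj (nome z) ^ p.2 := by
    intro k
    funext p
    simp only [Finsupp.add_apply, Pi.add_apply]
    ring
  refine ⟨fun k => by rw [key k]; exact (ha1 k).add (hb1 k), ?_⟩
  have e : ∀ (c : ℤ →₀ (ℕ × ℕ → ℂ)) (T : Finset ℤ), c.support ⊆ T →
      ∑ k ∈ c.support, LL z ^ k * ∑' p : ℕ × ℕ, c k p * nome z ^ p.1 * conj (nome z) ^ p.2 =
      ∑ k ∈ T, LL z ^ k * ∑' p : ℕ × ℕ, c k p * nome z ^ p.1 * conj (nome z) ^ p.2 := by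
    intro c T hT
    refine Finset.sum_subset hT fun k _ hk => ?_
    rw [Finsupp.notMem_support_iff] at hk
    simp [hk]
  classical
  rw [Pi.add_apply, ha2, hb2, e a (a.support ∪ b.support) Finset.subset_union_left,
    e b (a.support ∪ b.support) Finset.subset_union_right,
    e (a + b) (a.support ∪ b.support) Finsupp.support_add, ← Finset.sum_add_distrib]
  refine Finset.sum_congr rfl fun k _ => ?_
  rw [key k, (ha1 k).tsum_add (hb1 k), mul_add]

lemma HasCuspExpansion.smul (c : ℂ) {f : ℍ → ℂ} (hf : HasCuspExpansion f) :
    HasCuspExpansion (c • f) := by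
  obtain ⟨a, Y, ha⟩ := hf
  refine ⟨c • a, Y, fun z hz => ?_⟩
  obtain ⟨ha1, ha2⟩ := ha z hz
  have key : ∀ k, (fun p : ℕ × ℕ => (c • a) k p * nome z ^ p.1 * conj (nome z) ^ p.2) =
      fun p => c * (a k p * nome z ^ p.1 * conj (nome z) ^ p.2) := by
    intro k
    funext p
    simp only [Finsupp.smul_apply, Pi.smul_apply, smul_eq_mul]
    ring
  refine ⟨fun k => by rw [key k]; exact (ha1 k).mul_left c, ?_⟩
  have e : ∑ k ∈ (c • a).support,
        LL z ^ k * ∑' p : ℕ × ℕ, (c • a) k p * nome z ^ p.1 * conj (nome z) ^ p.2 =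
      ∑ k ∈ a.support,
        LL z ^ k * ∑' p : ℕ × ℕ, (c • a) k p * nome z ^ p.1 * conj (nome z) ^ p.2 := by
    refine Finset.sum_subset Finsupp.support_smul fun k _ hk => ?_
    rw [Finsupp.notMem_support_iff] at hk
    simp [hk]
  rw [e, Pi.smul_apply, smul_eq_mul, ha2, Finset.mul_sum]
  refine Finset.sum_congr rfl fun k _ => ?_
  rw [key k, tsum_mul_left]
  ring

/-- The space `M_{r,s}` of real analytic functions on the upper half plane which are modular of
weights `(r, s)` and admit an expansion in `ℂ[[q, conj q]][𝕃, 𝕃⁻¹]`. -/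
def M (r s : ℤ) : Submodule ℂ (ℍ → ℂ) where
  carrier := {f | IsRealAnalytic f ∧ IsModular r s f ∧ HasCuspExpansion f}
  zero_mem' := by
    refine ⟨analyticOnNhd_const, fun γ z => by simp, ⟨0, 0, fun z _ => ?_⟩⟩
    simp [summable_zero]
  add_mem' := by
    rintro f g ⟨hf1, hf2, hf3⟩ ⟨hg1, hg2, hg3⟩
    refine ⟨AnalyticOnNhd.add hf1 hg1, fun γ z => ?_, hf3.add hg3⟩
    rw [Pi.add_apply, Pi.add_apply, hf2 γ z, hg2 γ z, mul_add]
  smul_mem' := by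
    rintro c f ⟨hf1, hf2, hf3⟩
    refine ⟨AnalyticOnNhd.const_smul (c := c) hf1, fun γ z => ?_, hf3.smul c⟩
    rw [Pi.smul_apply, Pi.smul_apply, hf2 γ z, smul_eq_mul, smul_eq_mul]
    ring

/-- The Wirtinger derivative `∂f/∂z = (∂f/∂x - i ∂f/∂y) / 2`. -/
def wirtinger (f : ℍ → ℂ) (z : ℍ) : ℂ :=
  (fderiv ℝ (fun w : ℂ => f (ofComplex w)) z 1 -
    Complex.I * fderiv ℝ (fun w : ℂ => f (ofComplex w)) z Complex.I) / 2

/-- The operator `∂_r = (z - conj z) ∂/∂z + r`. -/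
def maass (r : ℤ) (f : ℍ → ℂ) (z : ℍ) : ℂ :=
  ((z : ℂ) - conj (z : ℂ)) * wirtinger f z + r * f z

/-- `f ∈ M_{r,s}` has a `∂`-primitive in the bigraded space `M = ⨁ M_{p,q}`: there is `F ∈ M` such
that `∂ F = f`, where `∂` acts on `M_{p,q}` by `∂_p` and has bidegree `(1, -1)`. The equation is
spelled out component by component. -/
def HasPrimitive {r s : ℤ} (f : M r s) : Prop :=
  ∃ F : ⨁ p : ℤ × ℤ, M p.1 p.2, ∀ p q : ℤ,
    maass p (F (p, q) : ℍ → ℂ) =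
      (DirectSum.of (fun p : ℤ × ℤ => M p.1 p.2) (r, s) f (p + 1, q - 1) : ℍ → ℂ)

/-- The integrand `f z * conj (g z) * y ^ n`. -/
def integrand (n : ℤ) (f g : ℍ → ℂ) (z : ℍ) : ℂ := f z * conj (g z) * (z.im : ℂ) ^ n

/-- The pairing `∫ f conj(g) y ^ n dvol` over the interior `𝒟ᵒ` of the standard fundamental
domain, where `dvol = dx dy / y ^ 2` is the standard measure on `ℍ`. -/
def pairing (n : ℤ) (f g : ℍ → ℂ) : ℂ := ∫ z in 𝒟ᵒ, integrand n f g z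


lemma continuous_of_mem {r s : ℤ} {f : ℍ → ℂ} (hf : f ∈ M r s) : Continuous f := by
  have h : ContinuousOn (fun w : ℂ => f (ofComplex w)) {w : ℂ | 0 < w.im} := hf.1.continuousOn
  have := h.comp_continuous continuous_coe (fun z => z.im_pos)
  refine this.congr fun z => ?_
  simp [ofComplex_apply]

lemma norm_nome (z : ℍ) : ‖nome z‖ = Real.exp (-2 * Real.pi * z.im) := by
  rw [nome, Complex.norm_exp]
  congr 1
  simp

lemma isBigO_of_mem {r s : ℤ} {f : ℍ → ℂ} (hf : f ∈ M r s) :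
    ∃ N : ℕ, f =O[atImInfty] fun z : ℍ => z.im ^ N := by
  obtain ⟨a, Y, ha⟩ := hf.2.2
  set Y₀ : ℝ := max Y 0 + 1 with hY₀
  have hY₀1 : 1 ≤ Y₀ := by linarith [le_max_right Y 0]
  have hY₀Y : Y < Y₀ := by linarith [le_max_left Y 0]
  let z₀ : ℍ := ⟨Complex.I * Y₀, by simp; linarith⟩
  have hz₀ : z₀.im = Y₀ := by simp [z₀, UpperHalfPlane.im]
  obtain ⟨hs, -⟩ := ha z₀ (by rw [hz₀]; exact hY₀Y)
  refine ⟨a.support.sup Int.natAbs, ?_⟩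
  refine Asymptotics.IsBigO.congr' (f₁ := fun z => ∑ k ∈ a.support,
    LL z ^ k * ∑' p : ℕ × ℕ, a k p * nome z ^ p.1 * conj (nome z) ^ p.2) ?_ ?_
    Filter.EventuallyEq.rfl
  swap
  · rw [Filter.EventuallyEq, atImInfty, Filter.eventually_comap]
    filter_upwards [Filter.eventually_gt_atTop Y] with y hy z hz
    exact (ha z (by rw [hz]; exact hy)).2.symm
  refine Asymptotics.IsBigO.fun_sum fun k hk => ?_
  refine Asymptotics.IsBigO.of_bound ((2 * Real.pi) ^ k *
    ∑' p : ℕ × ℕ, ‖a k p * nome z₀ ^ p.1 * conj (nome z₀) ^ p.2‖) ?_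
  rw [atImInfty, Filter.eventually_comap]
  filter_upwards [Filter.eventually_ge_atTop Y₀] with y hy z hz
  have hz1 : 1 ≤ z.im := by rw [hz]; linarith
  have hq : ‖nome z‖ ≤ ‖nome z₀‖ := by
    rw [norm_nome, norm_nome, hz₀, hz]
    apply Real.exp_le_exp.mpr
    nlinarith [Real.pi_pos]
  have hsz := (ha z (by rw [hz]; linarith)).1 k
  have hle : ‖∑' p : ℕ × ℕ, a k p * nome z ^ p.1 * conj (nome z) ^ p.2‖ ≤
      ∑' p : ℕ × ℕ, ‖a k p * nome z₀ ^ p.1 * conj (nome z₀) ^ p.2‖ := by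
    refine (norm_tsum_le_tsum_norm hsz.norm).trans (hsz.norm.tsum_le_tsum (fun p => ?_) (hs k).norm)
    simp only [norm_mul, norm_pow, RCLike.norm_conj]
    gcongr
  have hL : ‖LL z ^ k‖ ≤ (2 * Real.pi) ^ k * z.im ^ (a.support.sup Int.natAbs) := by
    have h1 : ‖LL z‖ = 2 * Real.pi * z.im := by
      rw [LL, Complex.norm_real, Real.norm_eq_abs, abs_mul, abs_mul, abs_of_pos z.im_pos,
        abs_of_pos Real.pi_pos]
      norm_num
    rw [norm_zpow, h1, mul_zpow]
    gcongr
    rw [← zpow_natCast]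
    apply zpow_le_zpow_right₀ hz1
    have : k.natAbs ≤ a.support.sup Int.natAbs := Finset.le_sup (f := Int.natAbs) hk
    omega
  rw [norm_mul, norm_pow, Real.norm_of_nonneg z.im_pos.le]
  calc _ ≤ ((2 * Real.pi) ^ k * z.im ^ (a.support.sup Int.natAbs)) *
      ∑' p : ℕ × ℕ, ‖a k p * nome z₀ ^ p.1 * conj (nome z₀) ^ p.2‖ := by gcongr
    _ = _ := by ring

lemma volume_fdo_lt_top : volume (𝒟ᵒ : Set ℍ) < ⊤ := by
  have hsub : ((↑) '' 𝒟ᵒ : Set ℂ) ⊆ Set.Icc (-1 : ℝ) 1 ×ℂ Set.Ioi (1 / 2 : ℝ) := by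
    rintro _ ⟨z, hz, rfl⟩
    have h1 := ModularGroup.three_lt_four_mul_im_sq_of_mem_fdo hz
    have h2 := abs_lt.mp hz.2
    refine ⟨⟨?_, ?_⟩, ?_⟩
    · simp; linarith
    · simp; linarith
    · simp only [Set.mem_preimage, coe_im, Set.mem_Ioi]
      nlinarith [z.im_pos]
  rw [volume_eq_lintegral]
  refine (lintegral_mono_set hsub).trans_lt ?_
  have hi : IntegrableOn (fun p : ℝ × ℝ => (1 : ℝ) * p.2 ^ (-2 : ℝ))
      (Set.Icc (-1 : ℝ) 1 ×ˢ Set.Ioi (1 / 2 : ℝ)) := by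
    rw [IntegrableOn, Measure.volume_eq_prod, ← Measure.prod_restrict]
    exact Integrable.mul_prod (f := fun _ : ℝ => (1 : ℝ)) (g := fun y : ℝ => y ^ (-2 : ℝ))
      (integrable_const _) (integrableOn_Ioi_rpow_of_lt (by norm_num) (by norm_num))
  have hmp := Complex.volume_preserving_equiv_real_prod
  have hpre : Set.Icc (-1 : ℝ) 1 ×ℂ Set.Ioi (1 / 2 : ℝ) =
      Complex.measurableEquivRealProd ⁻¹' (Set.Icc (-1 : ℝ) 1 ×ˢ Set.Ioi (1 / 2 : ℝ)) := by
    ext z; simp [Complex.mem_reProdIm]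
  have hi2 := (hmp.integrableOn_comp_preimage
    Complex.measurableEquivRealProd.measurableEmbedding).mpr hi
  rw [← hpre] at hi2
  refine lt_of_eq_of_lt ?_ hi2.2
  refine setLIntegral_congr_fun ?_ fun z hz => ?_
  · rw [hpre]
    exact Complex.measurableEquivRealProd.measurable
      (measurableSet_Icc.prod measurableSet_Ioi)
  · have hzpos : 0 < z.im := lt_trans (by norm_num) hz.2
    simp only [Function.comp, Complex.measurableEquivRealProd_apply, one_mul]
    rw [← ofReal_norm, Real.norm_of_nonneg (by positivity), ENNReal.coe_nnreal_eq]
    congr 1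
    rw [Real.rpow_neg hzpos.le]
    simp [abs_of_pos hzpos]

lemma integrableOn_of_growth {k : ℤ} (n : ℤ) {f : ℍ → ℂ} (hfc : Continuous f) {N : ℕ}
    (hN : f =O[atImInfty] fun z : ℍ => z.im ^ N)
    (g : CuspForm 𝒮ℒ k) : IntegrableOn (integrand n f g) 𝒟ᵒ := by
  have hgc : Continuous g := (CuspFormClass.holo g).continuous
  have hc : Continuous (integrand n f g) := by
    unfold integrand
    refine (hfc.mul (Complex.continuous_conj.comp hgc)).mul (Continuous.zpow₀ ?_ _ ?_)
    · exact Complex.continuous_ofReal.comp continuous_im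
    · intro z; left; exact_mod_cast z.im_ne_zero
  have hg := CuspFormClass.exp_decay_atImInfty (h := 1) g one_pos one_mem_strictPeriods_SL
  have hO : integrand n f g =O[atImInfty] fun z : ℍ => z.im ^ (0 : ℝ) := by
    have h1 : integrand n f g =O[atImInfty]
        fun z : ℍ => z.im ^ N * Real.exp (-2 * Real.pi * z.im / 1) * z.im ^ n := by
      refine (hN.mul ?_).mul ?_
      · refine Asymptotics.IsBigO.trans (Asymptotics.IsBigO.of_norm_right ?_) hg
        exact Asymptotics.IsBigO.of_norm_left (by
          simpa using Asymptotics.isBigO_refl (fun z => ‖g z‖) atImInfty)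
      · refine Asymptotics.IsBigO.of_norm_left ?_
        simpa [norm_zpow] using (Asymptotics.isBigO_refl (fun z : ℍ => z.im ^ n) atImInfty).norm_left
    refine h1.trans ?_
    have h2 : (fun t : ℝ => t ^ N * Real.exp (-2 * Real.pi * t / 1) * t ^ n) =O[Filter.atTop]
        fun t : ℝ => t ^ (0 : ℝ) := by
      have h3 := (isLittleO_exp_neg_mul_rpow_atTop (a := 2 * Real.pi)
        (by positivity) (-(N + n : ℝ))).isBigO
      have h4 := (Asymptotics.isBigO_refl (fun t : ℝ => t ^ (N + n : ℝ)) Filter.atTop).mul h3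
      refine h4.congr' ?_ ?_
      · filter_upwards [Filter.eventually_gt_atTop 0] with t ht
        rw [Real.rpow_add ht, Real.rpow_natCast, Real.rpow_intCast]
        ring_nf
      · filter_upwards [Filter.eventually_gt_atTop 0] with t ht
        rw [← Real.rpow_add ht]
        simp
    exact h2.comp_tendsto Filter.tendsto_comap
  obtain ⟨C, hC⟩ := ModularGroup.exists_bound_fundamental_domain_of_isBigO hc hO
  refine IntegrableOn.of_bound volume_fdo_lt_top hc.aestronglyMeasurable C ?_
  filter_upwards [ae_restrict_mem ModularGroup.isOpen_fdo.measurableSet] with z hz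
  simpa using hC z (ModularGroup.fdo_subset_fd hz)

/-- The integral defining the pairing of `M_{r,s}` with cusp forms converges. -/
lemma integrableOn_integrand {r s k : ℤ} (n : ℤ) {f : ℍ → ℂ} (hf : f ∈ M r s)
    (g : CuspForm 𝒮ℒ k) : IntegrableOn (integrand n f g) 𝒟ᵒ := by
  obtain ⟨N, hN⟩ := isBigO_of_mem hf
  exact integrableOn_of_growth n (continuous_of_mem hf) hN g

lemma integrableOn_cuspForm {k : ℤ} (n : ℤ) (f g : CuspForm 𝒮ℒ k) :
    IntegrableOn (integrand n f g) 𝒟ᵒ := by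
  refine integrableOn_of_growth n (N := 0) (CuspFormClass.holo f).continuous ?_ g
  have h : IsBoundedAtImInfty f := ModularFormClass.bdd_at_infty f
  simpa only [pow_zero] using (show f =O[atImInfty] fun _ => (1 : ℝ) from h)

lemma pairing_add_left {n : ℤ} {f₁ f₂ g : ℍ → ℂ} (h₁ : IntegrableOn (integrand n f₁ g) 𝒟ᵒ)
    (h₂ : IntegrableOn (integrand n f₂ g) 𝒟ᵒ) :
    pairing n (f₁ + f₂) g = pairing n f₁ g + pairing n f₂ g := by
  rw [pairing, pairing, pairing, ← integral_add h₁ h₂]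
  refine integral_congr_ae (.of_forall fun z => ?_)
  simp only [integrand, Pi.add_apply]
  ring

lemma pairing_smul_left (n : ℤ) (c : ℂ) (f g : ℍ → ℂ) :
    pairing n (c • f) g = c * pairing n f g := by
  rw [pairing, pairing, ← integral_const_mul]
  refine integral_congr_ae (.of_forall fun z => ?_)
  simp only [integrand, Pi.smul_apply, smul_eq_mul]
  ring

lemma pairing_add_right {n : ℤ} {f g₁ g₂ : ℍ → ℂ} (h₁ : IntegrableOn (integrand n f g₁) 𝒟ᵒ)
    (h₂ : IntegrableOn (integrand n f g₂) 𝒟ᵒ) :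
    pairing n f (g₁ + g₂) = pairing n f g₁ + pairing n f g₂ := by
  rw [pairing, pairing, pairing, ← integral_add h₁ h₂]
  refine integral_congr_ae (.of_forall fun z => ?_)
  simp only [integrand, Pi.add_apply, map_add]
  ring

lemma pairing_smul_right (n : ℤ) (c : ℂ) (f g : ℍ → ℂ) :
    pairing n f (c • g) = conj c * pairing n f g := by
  rw [pairing, pairing, ← integral_const_mul]
  refine integral_congr_ae (.of_forall fun z => ?_)
  simp only [integrand, Pi.smul_apply, smul_eq_mul, map_mul]
  ring

lemma pairing_conj_symm (n : ℤ) (f g : ℍ → ℂ) : conj (pairing n f g) = pairing n g f := by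
  rw [pairing, pairing, ← integral_conj]
  refine integral_congr_ae (.of_forall fun z => ?_)
  simp only [integrand, map_mul, map_zpow₀, Complex.conj_ofReal, Complex.conj_conj]
  ring

lemma pairing_self (n : ℤ) (f : ℍ → ℂ) :
    pairing n f f = ((∫ z in 𝒟ᵒ, ‖f z‖ ^ 2 * z.im ^ n : ℝ) : ℂ) := by
  rw [pairing, ← integral_complex_ofReal]
  refine integral_congr_ae (.of_forall fun z => ?_)
  simp [integrand, Complex.mul_conj, Complex.normSq_eq_norm_sq]

lemma isOpenPosMeasure_volume : (volume : Measure ℍ).IsOpenPosMeasure := by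
  have h1 : ((volume : Measure ℂ).comap ((↑) : ℍ → ℂ)).IsOpenPosMeasure :=
    Measure.IsOpenPosMeasure.comap _ isOpenEmbedding_coe
  rw [volume_def]
  refine (withDensity_absolutelyContinuous' ?_ ?_).isOpenPosMeasure
  · refine Measurable.aemeasurable (Measurable.coe_nnreal_ennreal (Continuous.measurable ?_))
    refine .pow (.div₀ continuous_const ?_ ?_) _
    · exact continuous_im.subtype_mk _
    · exact fun x => NNReal.ne_iff.mp x.im_ne_zero
  · refine .of_forall fun z => ?_
    have h2 : (1 / NNReal.mk z.im z.im_pos.le) ^ 2 ≠ 0 :=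
      pow_ne_zero _ (one_div_ne_zero (NNReal.ne_iff.mp z.im_ne_zero))
    exact_mod_cast h2

lemma cuspForm_eq_zero_of_pairing_self {k : ℤ} (f : CuspForm 𝒮ℒ k) (h : pairing k f f = 0) :
    f = 0 := by
  have hfc : Continuous f := (CuspFormClass.holo f).continuous
  rw [pairing_self, Complex.ofReal_eq_zero] at h
  have := isOpenPosMeasure_volume
  have hnn : ∀ z : ℍ, 0 ≤ ‖f z‖ ^ 2 * z.im ^ k := fun z => by positivity
  have hint : IntegrableOn (fun z : ℍ => ‖f z‖ ^ 2 * z.im ^ k) 𝒟ᵒ := by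
    refine (integrableOn_cuspForm k f f).norm.congr (.of_forall fun z => ?_)
    simp only [integrand, norm_mul, RCLike.norm_conj, norm_zpow, Complex.norm_real,
      Real.norm_of_nonneg z.im_pos.le]
    ring
  have hae := (setIntegral_eq_zero_iff_of_nonneg_ae (.of_forall hnn) hint).mp h
  have hcont : Continuous fun z : ℍ => ‖f z‖ ^ 2 * z.im ^ k :=
    (hfc.norm.pow 2).mul (continuous_im.zpow₀ k fun z => Or.inl z.im_ne_zero)
  have h0 : Set.EqOn (fun z : ℍ => ‖f z‖ ^ 2 * z.im ^ k) 0 𝒟ᵒ :=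
    Measure.eqOn_open_of_ae_eq hae ModularGroup.isOpen_fdo hcont.continuousOn
      continuousOn_const
  have h1 : Set.EqOn f 0 𝒟ᵒ := fun z hz => by
    have := h0 hz
    simpa [z.im_ne_zero, zpow_ne_zero] using this
  have h2 : Set.EqOn f 0 𝒟 := by
    rw [ModularGroup.fd_eq_closure_fdo]
    exact h1.closure hfc continuous_const
  ext z
  obtain ⟨γ, hγ⟩ := ModularGroup.exists_smul_mem_fd z
  have h3 := SlashInvariantForm.slash_action_eqn'' f
    (γ := (γ : GL (Fin 2) ℝ)) (show (γ : GL (Fin 2) ℝ) ∈ 𝒮ℒ from ⟨γ, rfl⟩) z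
  have h4 : f ((γ : GL (Fin 2) ℝ) • z) = 0 := h2 hγ
  rw [h4] at h3
  simpa [denom_ne_zero, zpow_ne_zero] using h3.symm

/-- The conjugate linear functional `g ↦ ⟨f, g⟩` on the space `S_{r-s}` of holomorphic cusp forms
of weight `r - s`, as a linear function of `f ∈ M_{r,s}`. -/
def pairingFunctional (r s : ℤ) : M r s →ₗ[ℂ] (CuspForm 𝒮ℒ (r - s) →ₗ⋆[ℂ] ℂ) where
  toFun f :=
    { toFun := fun g => pairing r f g
      map_add' := fun g₁ g₂ => pairing_add_right (integrableOn_integrand r f.2 g₁)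
        (integrableOn_integrand r f.2 g₂)
      map_smul' := fun c g => pairing_smul_right r c f g }
  map_add' f₁ f₂ := by
    ext g
    exact pairing_add_left (integrableOn_integrand r f₁.2 g) (integrableOn_integrand r f₂.2 g)
  map_smul' c f := by
    ext g
    exact pairing_smul_left r c f g

/-- The classical Petersson inner product `⟨φ, g⟩ = ∫ φ conj(g) y ^ k dvol` on cusp forms of
weight `k`, viewed as the map sending `φ` to the functional `g ↦ ⟨φ, g⟩`. -/
def petersson (k : ℤ) : CuspForm 𝒮ℒ k →ₗ[ℂ] (CuspForm 𝒮ℒ k →ₗ⋆[ℂ] ℂ) where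
  toFun φ :=
    { toFun := fun g => pairing k φ g
      map_add' := fun g₁ g₂ => pairing_add_right (integrableOn_cuspForm k φ g₁)
        (integrableOn_cuspForm k φ g₂)
      map_smul' := fun c g => pairing_smul_right k c φ g }
  map_add' f₁ f₂ := by
    ext g
    exact pairing_add_left (integrableOn_cuspForm k f₁ g) (integrableOn_cuspForm k f₂ g)
  map_smul' c f := by
    ext g
    exact pairing_smul_left k c f g

lemma petersson_bijective (k : ℤ) : Function.Bijective (petersson k) := by
  constructor
  · rw [← LinearMap.ker_eq_bot, LinearMap.ker_eq_bot']
    intro φ hφ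
    exact cuspForm_eq_zero_of_pairing_self φ (LinearMap.congr_fun hφ φ)
  · intro l
    have hfin : FiniteDimensional ℂ (CuspForm 𝒮ℒ k) :=
      FiniteDimensional.of_injective _ CuspForm.toModularFormₗ_injective
    let core : InnerProductSpace.Core ℂ (CuspForm 𝒮ℒ k) :=
      { inner := fun f g => petersson k g f
        conj_inner_symm := fun f g => pairing_conj_symm k f g
        re_inner_nonneg := fun f => by
          change 0 ≤ (pairing k f f).re
          rw [pairing_self, Complex.ofReal_re]
          exact integral_nonneg fun z => by positivity
        add_left := fun f g h => map_add (petersson k h) f g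
        smul_left := fun f g c => LinearMap.map_smulₛₗ (petersson k g) c f
        definite := fun f hf => cuspForm_eq_zero_of_pairing_self f hf }
    let : NormedAddCommGroup (CuspForm 𝒮ℒ k) := core.toNormedAddCommGroup
    let : InnerProductSpace ℂ (CuspForm 𝒮ℒ k) := InnerProductSpace.ofCore core.toCore
    have : CompleteSpace (CuspForm 𝒮ℒ k) := FiniteDimensional.complete ℂ _
    let l' : CuspForm 𝒮ℒ k →ₗ[ℂ] ℂ :=
      { toFun := fun g => conj (l g)
        map_add' := fun f g => by simp
        map_smul' := fun c g => by simp }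
    refine ⟨(InnerProductSpace.toDual ℂ _).symm (LinearMap.toContinuousLinearMap l'), ?_⟩
    ext g
    have h := InnerProductSpace.toDual_symm_apply (𝕜 := ℂ) (x := g)
      (y := LinearMap.toContinuousLinearMap l')
    have h2 : pairing k g ((InnerProductSpace.toDual ℂ (CuspForm 𝒮ℒ k)).symm
      (LinearMap.toContinuousLinearMap l')) = conj (l g) := h
    change pairing k _ g = l g
    rw [← pairing_conj_symm, h2, Complex.conj_conj]

/-- The identification of `S_k` with its space of conjugate linear functionals given by the
Petersson inner product. -/
def peterssonEquiv (k : ℤ) : CuspForm 𝒮ℒ k ≃ₗ[ℂ] (CuspForm 𝒮ℒ k →ₗ⋆[ℂ] ℂ) :=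
  LinearEquiv.ofBijective (petersson k) (petersson_bijective k)

/-- The holomorphic projection `p^h : M_{r,s} → S_{r-s}`: the cusp form `p^h f` is characterised by
`⟨p^h f, g⟩ = ⟨f, g⟩` for all `g ∈ S_{r-s}`. -/
def holomorphicProjection (r s : ℤ) : M r s →ₗ[ℂ] CuspForm 𝒮ℒ (r - s) :=
  (peterssonEquiv (r - s)).symm.toLinearMap ∘ₗ pairingFunctional r s

lemma pairing_holomorphicProjection {r s : ℤ} (f : M r s) (g : CuspForm 𝒮ℒ (r - s)) :
    pairing (r - s) (holomorphicProjection r s f) g = pairing r f g :=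
  LinearMap.congr_fun ((peterssonEquiv (r - s)).apply_symm_apply (pairingFunctional r s f)) g

end RealAnalyticModular

end

noncomputable section

namespace RealAnalyticModular

/-! The argument is Stokes' theorem for an invariant 1-form. Since `∂` has bidegree `(1, -1)`, `f`
equals `∂_n F` with `n = r - 1` and `F ∈ M n (s + 1)`. Put `ω = y ^ n F conj(g) d(conj z)`. The
coefficient has weights `(0, 2)`, so `ω` is invariant under `SL(2, ℤ)`. As `conj g` is
antiholomorphic and `∂/∂z (y ^ n F) = y ^ n (z - conj z)⁻¹ ∂_n F`, the differential `dω` is `-f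
conj(g) y ^ r dx dy / y ^ 2` (`hasFDerivAt_potential`).

Over a truncated fundamental domain the two vertical sides cancel by `T` (`potential_add_one`), and
the unit arc cancels against itself by `S` (`potential_neg_conj`). The top edge tends to zero
because `g` decays exponentially while `F` grows at most polynomially (`potential_small`). The
domain is truncated by a translate of the unit arc, not by a horizontal line: the shear `strip` then
turns it into a rectangle, where the divergence theorem applies directly
(`integral_strip_of_invariant`). -/

/-! ### The unit arc as a graph, and sheared coordinates on the strip. -/

/-- The height of the unit circle above `x`. -/
def arcHeight (x : ℝ) : ℝ := √(1 - x ^ 2)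

lemma continuous_arcHeight : Continuous arcHeight := by
  unfold arcHeight; fun_prop

lemma arcHeight_neg (x : ℝ) : arcHeight (-x) = arcHeight x := by
  simp [arcHeight]

lemma sq_le_quarter {x : ℝ} (hx : x ∈ Set.Icc (-(1 / 2) : ℝ) (1 / 2)) : x ^ 2 ≤ 1 / 4 := by
  nlinarith [hx.1, hx.2]

lemma sq_arcHeight {x : ℝ} (hx : x ∈ Set.Icc (-(1 / 2) : ℝ) (1 / 2)) :
    arcHeight x ^ 2 = 1 - x ^ 2 :=
  Real.sq_sqrt (by linarith [sq_le_quarter hx])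

/-- Not sharp (the minimum is `√3 / 2`), but enough to keep the arc away from the real axis, where
`arcHeight` fails to be differentiable, and to dominate `|x|` in the bound on `slope`. -/
lemma half_lt_arcHeight {x : ℝ} (hx : x ∈ Set.Icc (-(1 / 2) : ℝ) (1 / 2)) :
    1 / 2 < arcHeight x :=
  Real.lt_sqrt_of_sq_lt (by linarith [sq_le_quarter hx])

lemma hasDerivAt_arcHeight {x : ℝ} (hx : x ∈ Set.Icc (-(1 / 2) : ℝ) (1 / 2)) :
    HasDerivAt arcHeight (-x / arcHeight x) x := by
  have h : HasDerivAt (fun x : ℝ => 1 - x ^ 2) (-(2 * x)) x := by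
    simpa using (hasDerivAt_pow 2 x).const_sub 1
  refine (h.sqrt (by linarith [sq_le_quarter hx])).congr_deriv ?_
  change _ / (2 * arcHeight x) = _
  have := half_lt_arcHeight hx
  field_simp

/-- Coordinates on the vertical strip in which the part of the strip above the unit circle becomes
`0 < t`. -/
def strip (p : ℝ × ℝ) : ℂ := ⟨p.1, arcHeight p.1 + p.2⟩

lemma strip_eq (p : ℝ × ℝ) :
    strip p = (p.1 : ℂ) + (arcHeight p.1 : ℂ) * Complex.I + (p.2 : ℂ) * Complex.I := by
  apply Complex.ext <;> simp [strip]

lemma continuous_strip : Continuous strip := by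
  have := continuous_arcHeight
  simp_rw [funext strip_eq]
  fun_prop

lemma strip_im_pos {p : ℝ × ℝ} (h1 : p.1 ∈ Set.Icc (-(1 / 2) : ℝ) (1 / 2)) (h2 : 0 ≤ p.2) :
    0 < (strip p).im := by
  change 0 < arcHeight p.1 + p.2
  linarith [half_lt_arcHeight h1]

/-- The derivative of `strip`. -/
def stripDeriv (p : ℝ × ℝ) : ℝ × ℝ →L[ℝ] ℂ :=
  (ContinuousLinearMap.fst ℝ ℝ ℝ).smulRight (1 + (-p.1 / arcHeight p.1 : ℝ) * Complex.I : ℂ) +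
    (ContinuousLinearMap.snd ℝ ℝ ℝ).smulRight Complex.I

lemma hasFDerivAt_strip {p : ℝ × ℝ} (hp : p.1 ∈ Set.Icc (-(1 / 2) : ℝ) (1 / 2)) :
    HasFDerivAt strip (stripDeriv p) p := by
  have h1 : HasFDerivAt (fun p : ℝ × ℝ => (p.1 : ℂ))
      (Complex.ofRealCLM.comp (ContinuousLinearMap.fst ℝ ℝ ℝ)) p :=
    (Complex.ofRealCLM.comp (ContinuousLinearMap.fst ℝ ℝ ℝ)).hasFDerivAt
  have h2 : HasFDerivAt (fun p : ℝ × ℝ => (p.2 : ℂ))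
      (Complex.ofRealCLM.comp (ContinuousLinearMap.snd ℝ ℝ ℝ)) p :=
    (Complex.ofRealCLM.comp (ContinuousLinearMap.snd ℝ ℝ ℝ)).hasFDerivAt
  have h3 := Complex.ofRealCLM.hasFDerivAt.comp p
    ((hasDerivAt_arcHeight hp).comp_hasFDerivAt p hasFDerivAt_fst)
  have h4 := (h1.add (h3.mul_const Complex.I)).add (h2.mul_const Complex.I)
  refine (h4.congr_fderiv ?_).congr_of_eventuallyEq (.of_forall fun q => ?_)
  · ext
    · simp [stripDeriv]; ring
    · simp [stripDeriv]
  · simpa using strip_eq q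

/-! ### Stokes' theorem on the truncated and on the full fundamental domain. -/

/-- The slope factor in the pullback of `-i d(conj z)` to a curve parallel to the unit circle. -/
def slope (x : ℝ) : ℂ := (x / arcHeight x : ℝ) - Complex.I

lemma differentiableAt_slope {x : ℝ} (hx : x ∈ Set.Icc (-(1 / 2) : ℝ) (1 / 2)) :
    DifferentiableAt ℝ slope x := by
  have h := (differentiableAt_id (𝕜 := ℝ) (x := x)).div (hasDerivAt_arcHeight hx).differentiableAt
    (by linarith [half_lt_arcHeight hx])
  exact (Complex.ofRealCLM.differentiableAt.comp x h).sub_const _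

lemma norm_slope_le {x : ℝ} (hx : x ∈ Set.Icc (-(1 / 2) : ℝ) (1 / 2)) : ‖slope x‖ ≤ 2 := by
  have h0 := half_lt_arcHeight hx
  refine (norm_sub_le _ _).trans ?_
  rw [Complex.norm_real, Complex.norm_I, Real.norm_eq_abs, abs_div,
    abs_of_pos (by linarith : 0 < arcHeight x)]
  have : |x| / arcHeight x ≤ 1 := by
    rw [div_le_one (by linarith)]
    linarith [abs_le.mpr hx]
  linarith

/-- Stokes' theorem for the form `H d(conj z)` on the part of the standard fundamental domain below
a translate of the unit circle, if the form is invariant under the two side pairings. -/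
lemma integral_strip_of_invariant {H : ℂ → ℂ} {H' : ℂ → ℂ →L[ℝ] ℂ}
    (hH : ∀ w : ℂ, 0 < w.im → HasFDerivAt H (H' w) w)
    (hK : ContinuousOn (fun w => H' w 1 - Complex.I * H' w Complex.I) {w : ℂ | 0 < w.im})
    (hT : ∀ w : ℂ, 0 < w.im → H (w + 1) = H w)
    (hS : ∀ w : ℂ, 0 < w.im → ‖w‖ = 1 → H (-conj w) = conj w ^ 2 * H w)
    {T : ℝ} (hT0 : 0 ≤ T) :
    ∫ p in Set.Icc (-(1 / 2) : ℝ) (1 / 2) ×ˢ Set.Icc 0 T,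
        (H' (strip p) 1 - Complex.I * H' (strip p) Complex.I) =
      ∫ x in (-(1 / 2) : ℝ)..(1 / 2), slope x * H (strip (x, T)) := by
  set R := Set.Icc (-(1 / 2) : ℝ) (1 / 2) ×ˢ Set.Icc 0 T with hR
  have hR' : R = Set.Icc ((-(1 / 2), 0) : ℝ × ℝ) ((1 / 2), T) := by
    rw [hR, Set.Icc_prod_eq]
  have hpos : ∀ p ∈ R, 0 < (strip p).im := fun p hp => strip_im_pos hp.1 hp.2.1
  let f' : ℝ × ℝ → ℝ × ℝ →L[ℝ] ℂ := fun p => (H' (strip p)).comp (stripDeriv p)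
  let g' : ℝ × ℝ → ℝ × ℝ →L[ℝ] ℂ := fun p => slope p.1 • f' p +
    (H (strip p)) • ((ContinuousLinearMap.fst ℝ ℝ ℝ).smulRight (deriv slope p.1))
  have hf : ∀ p ∈ R, HasFDerivAt (fun p => H (strip p)) (f' p) p := fun p hp =>
    (hH _ (hpos p hp)).comp p (hasFDerivAt_strip hp.1)
  have hg : ∀ p ∈ R, HasFDerivAt (fun p : ℝ × ℝ => slope p.1 * H (strip p)) (g' p) p := by
    intro p hp
    have h1 : HasFDerivAt (fun p : ℝ × ℝ => slope p.1)
        ((ContinuousLinearMap.fst ℝ ℝ ℝ).smulRight (deriv slope p.1)) p := by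
      refine ((differentiableAt_slope hp.1).hasDerivAt.hasFDerivAt.comp p
        hasFDerivAt_fst).congr_fderiv ?_
      ext <;> simp
    exact h1.mul (hf p hp)
  -- The field `(H, slope * H)` is chosen for this identity: differentiating along the arc produces
  -- `-(x / arcHeight x) * H' I`, which the real part of `slope` cancels, leaving `2 ∂H/∂z`.
  have hdiv : ∀ p ∈ R, f' p (1, 0) + g' p (0, 1) =
      H' (strip p) 1 - Complex.I * H' (strip p) Complex.I := by
    intro p hp
    have e : H' (strip p) (1 + ((-p.1 / arcHeight p.1 : ℝ) : ℂ) * Complex.I) =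
        H' (strip p) 1 + ((-p.1 / arcHeight p.1 : ℝ) : ℂ) * H' (strip p) Complex.I := by
      rw [← Complex.real_smul, ← Complex.real_smul, map_add, map_smul]
    simp only [f', g', stripDeriv, ContinuousLinearMap.comp_apply, add_apply,
      ContinuousLinearMap.smulRight_apply, ContinuousLinearMap.coe_fst', smul_apply,
      ContinuousLinearMap.coe_snd', one_smul, zero_smul, add_zero, zero_add, e,
      slope, smul_eq_mul]
    push_cast
    ring
  -- Only the divergence has to be integrable, so continuity of the single combination `2 ∂H/∂z`
  -- suffices; the separate partial derivatives need not be continuous.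
  have hcont : ContinuousOn (fun p => H' (strip p) 1 - Complex.I * H' (strip p) Complex.I) R :=
    hK.comp continuous_strip.continuousOn hpos
  have hcomp : IsCompact R := isCompact_Icc.prod isCompact_Icc
  have hmeas : MeasurableSet R := measurableSet_Icc.prod measurableSet_Icc
  have key := integral_divergence_prod_Icc_of_hasFDerivAt_of_le (fun p => H (strip p))
    (fun p => slope p.1 * H (strip p)) f' g' (-(1 / 2), 0) (1 / 2, T)
    ⟨by norm_num, hT0⟩
    (by rw [← hR']; exact fun p hp => (hf p hp).continuousAt.continuousWithinAt)
    (by rw [← hR']; exact fun p hp => (hg p hp).continuousAt.continuousWithinAt)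
    (fun p hp => hf p ⟨Set.Ioo_subset_Icc_self hp.1, Set.Ioo_subset_Icc_self hp.2⟩)
    (fun p hp => hg p ⟨Set.Ioo_subset_Icc_self hp.1, Set.Ioo_subset_Icc_self hp.2⟩)
    (by
      rw [← hR']
      exact (hcont.integrableOn_compact hcomp).congr_fun (fun p hp => (hdiv p hp).symm) hmeas)
  rw [← hR', setIntegral_congr_fun hmeas hdiv] at key
  -- The vertical sides differ by the translation `w ↦ w + 1`.
  have hside : ∫ t in (0 : ℝ)..T, H (strip (1 / 2, t)) =
      ∫ t in (0 : ℝ)..T, H (strip (-(1 / 2), t)) := by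
    refine intervalIntegral.integral_congr fun t ht => ?_
    rw [Set.uIcc_of_le hT0] at ht
    have h := hT (strip (-(1 / 2), t)) (strip_im_pos (by norm_num) ht.1)
    rw [← h]
    congr 1
    simp only [strip_eq, arcHeight_neg]
    push_cast
    ring
  -- On the unit circle `-1 / w = -conj w`, so `S` acts on the arc as `x ↦ -x`. The integrand is odd
  -- under this reflection.
  have hbot : ∫ x in (-(1 / 2) : ℝ)..(1 / 2), slope x * H (strip (x, 0)) = 0 := by
    have hodd : ∫ x in (-(1 / 2) : ℝ)..(1 / 2), slope (-x) * H (strip (-x, 0)) =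
        ∫ x in (-(1 / 2) : ℝ)..(1 / 2), -(slope x * H (strip (x, 0))) := by
      refine intervalIntegral.integral_congr fun x hx => ?_
      rw [Set.uIcc_of_le (by norm_num)] at hx
      have h0 := half_lt_arcHeight hx
      have h1 := sq_arcHeight hx
      have hn : ‖strip (x, 0)‖ = 1 := by
        rw [← sq_eq_sq₀ (norm_nonneg _) zero_le_one, Complex.sq_norm, Complex.normSq_apply]
        simp only [strip]
        linarith
      have hc : strip (-x, 0) = -conj (strip (x, 0)) := by
        apply Complex.ext <;> simp [strip, arcHeight_neg]
      -- For `w` on the arc, `slope x = conj w / arcHeight x` and `slope (-x) = -w / arcHeight x`.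
      -- With `w * conj w = 1` this gives `slope (-x) * conj w ^ 2 = -slope x`, the identity checked
      -- below.
      rw [hc, hS _ (strip_im_pos hx le_rfl) hn, ← mul_assoc, ← neg_mul]
      congr 1
      have h2 : (arcHeight x : ℂ) ≠ 0 := by exact_mod_cast (by linarith : arcHeight x ≠ 0)
      have h3 : (arcHeight x : ℂ) ^ 2 = 1 - (x : ℂ) ^ 2 := by exact_mod_cast h1
      simp only [slope, strip_eq, arcHeight_neg, map_add, map_mul, Complex.conj_ofReal,
        Complex.conj_I]
      push_cast
      field_simp
      linear_combination (Complex.I * arcHeight x - x) * h3 +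
        (x * arcHeight x ^ 2 - Complex.I * arcHeight x ^ 3) * Complex.I_sq
    rw [intervalIntegral.integral_comp_neg (fun x => slope x * H (strip (x, 0))),
      intervalIntegral.integral_neg, neg_neg] at hodd
    linear_combination hodd / 2
  rw [key]
  dsimp only
  rw [hside, hbot]
  ring

/-- Exhaustion by the rectangles of height `n`: integrability makes the truncated integrals converge
to the full one, and each equals its top edge, which tends to zero. -/
lemma integral_strip_eq_zero {H : ℂ → ℂ} {H' : ℂ → ℂ →L[ℝ] ℂ}
    (hH : ∀ w : ℂ, 0 < w.im → HasFDerivAt H (H' w) w)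
    (hK : ContinuousOn (fun w => H' w 1 - Complex.I * H' w Complex.I) {w : ℂ | 0 < w.im})
    (hT : ∀ w : ℂ, 0 < w.im → H (w + 1) = H w)
    (hS : ∀ w : ℂ, 0 < w.im → ‖w‖ = 1 → H (-conj w) = conj w ^ 2 * H w)
    (h0 : ∀ ε > 0, ∃ Y : ℝ, ∀ w : ℂ, Y < w.im → ‖H w‖ ≤ ε)
    (hi : IntegrableOn (fun p => H' (strip p) 1 - Complex.I * H' (strip p) Complex.I)
      (Set.Icc (-(1 / 2) : ℝ) (1 / 2) ×ˢ Set.Ici 0)) :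
    ∫ p in Set.Icc (-(1 / 2) : ℝ) (1 / 2) ×ˢ Set.Ici 0,
        (H' (strip p) 1 - Complex.I * H' (strip p) Complex.I) = 0 := by
  have hU : (⋃ n : ℕ, Set.Icc (-(1 / 2) : ℝ) (1 / 2) ×ˢ Set.Icc 0 (n : ℝ)) =
      Set.Icc (-(1 / 2) : ℝ) (1 / 2) ×ˢ Set.Ici 0 := by
    ext p
    simp only [Set.mem_iUnion, Set.mem_prod, Set.mem_Icc, Set.mem_Ici]
    constructor
    · rintro ⟨n, h1, h2⟩; exact ⟨h1, h2.1⟩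
    · rintro ⟨h1, h2⟩
      obtain ⟨n, hn⟩ := exists_nat_ge p.2
      exact ⟨n, h1, h2, hn⟩
  have h1 := tendsto_setIntegral_of_monotone (μ := volume)
    (f := fun p => H' (strip p) 1 - Complex.I * H' (strip p) Complex.I)
    (s := fun n : ℕ => Set.Icc (-(1 / 2) : ℝ) (1 / 2) ×ˢ Set.Icc 0 (n : ℝ))
    (fun n => measurableSet_Icc.prod measurableSet_Icc)
    (fun m n hmn => Set.prod_mono le_rfl (Set.Icc_subset_Icc le_rfl (by exact_mod_cast hmn)))
    (by rw [hU]; exact hi)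
  rw [hU] at h1
  refine tendsto_nhds_unique h1 ?_
  rw [Metric.tendsto_atTop]
  intro ε hε
  -- The edge has width `1` and `slope` is bounded by `2`, so the top integral is at most `ε / 2`.
  obtain ⟨Y, hY⟩ := h0 (ε / 4) (by positivity)
  obtain ⟨N, hN⟩ := exists_nat_ge Y
  refine ⟨N, fun n hn => ?_⟩
  rw [integral_strip_of_invariant hH hK hT hS n.cast_nonneg, dist_zero_right]
  have hnN : (N : ℝ) ≤ n := by exact_mod_cast hn
  have hb := intervalIntegral.norm_integral_le_of_norm_le_const (C := 2 * (ε / 4))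
    (f := fun x => slope x * H (strip (x, n))) (a := (-(1 / 2) : ℝ)) (b := 1 / 2) fun x hx => by
      rw [Set.uIoc_of_le (by norm_num)] at hx
      have hx' := Set.Ioc_subset_Icc_self hx
      rw [norm_mul]
      refine mul_le_mul (norm_slope_le hx') (hY _ ?_) (norm_nonneg _) zero_le_two
      change Y < arcHeight x + n
      linarith [half_lt_arcHeight hx']
  refine hb.trans_lt ?_
  norm_num
  linarith

/-! ### Transfer of the invariant measure to strip coordinates. -/

/-- `strip` as a measurable equivalence. -/
def stripEquiv : ℝ × ℝ ≃ᵐ ℂ where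
  toFun := strip
  invFun w := (w.re, w.im - arcHeight w.re)
  left_inv p := by simp [strip]
  right_inv w := by apply Complex.ext <;> simp [strip]
  measurable_toFun := continuous_strip.measurable
  measurable_invFun := by
    have := continuous_arcHeight
    exact Continuous.measurable
      (f := fun w : ℂ => (w.re, w.im - arcHeight w.re)) (by fun_prop)

/-- A shear translates each vertical line, hence preserves Lebesgue measure. -/
lemma measurePreserving_strip : MeasurePreserving strip := by
  have h1 : MeasurePreserving (fun p : ℝ × ℝ => (p.1, arcHeight p.1 + p.2)) := by
    refine (MeasurePreserving.id volume).skew_product (g := fun x t => arcHeight x + t) ?_ ?_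
    · have := continuous_arcHeight
      exact Continuous.measurable
        (f := fun p : ℝ × ℝ => arcHeight p.1 + p.2) (by fun_prop)
    · exact .of_forall fun x => (measurePreserving_add_left volume (arcHeight x)).map_eq
  exact Complex.volume_preserving_equiv_real_prod.symm.comp h1

/-- Over `|x| < 1 / 2`, a point with positive imaginary part satisfies `|z| > 1` exactly when it
lies above the arc. -/
lemma strip_preimage_fdo :
    strip ⁻¹' ((↑) '' (𝒟ᵒ : Set ℍ)) = Set.Ioo (-(1 / 2) : ℝ) (1 / 2) ×ˢ Set.Ioi 0 := by
  ext p
  constructor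
  · rintro ⟨z, ⟨h1, h2⟩, hz⟩
    have hre : z.re = p.1 := congrArg Complex.re hz
    have him : z.im = arcHeight p.1 + p.2 := congrArg Complex.im hz
    rw [hre] at h2
    have hx := abs_lt.mp h2
    have hx' : p.1 ∈ Set.Icc (-(1 / 2) : ℝ) (1 / 2) := ⟨hx.1.le, hx.2.le⟩
    refine ⟨hx, ?_⟩
    rw [Complex.normSq_apply, coe_re, coe_im, hre, him] at h1
    have h3 := sq_arcHeight hx'
    have h4 := z.im_pos
    rw [him] at h4
    by_contra h5
    rw [Set.mem_Ioi, not_lt] at h5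
    nlinarith [half_lt_arcHeight hx']
  · rintro ⟨hx, ht⟩
    have hx' := Set.Ioo_subset_Icc_self hx
    refine ⟨⟨strip p, strip_im_pos hx' ht.le⟩, ⟨?_, abs_lt.mpr hx⟩, rfl⟩
    rw [Complex.normSq_apply]
    simp only [strip]
    nlinarith [half_lt_arcHeight hx', sq_arcHeight hx', Set.mem_Ioi.mp ht]

lemma strip_ae_eq : (Set.Ioo (-(1 / 2) : ℝ) (1 / 2) ×ˢ Set.Ioi (0 : ℝ)) =ᵐ[volume]
    Set.Icc (-(1 / 2) : ℝ) (1 / 2) ×ˢ Set.Ici (0 : ℝ) :=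
  Measure.set_prod_ae_eq Ioo_ae_eq_Icc Ioi_ae_eq_Ici

lemma measurePreserving_coe : MeasurePreserving UpperHalfPlane.coe
    (volume.comap UpperHalfPlane.coe) (volume.restrict (.range UpperHalfPlane.coe)) :=
  ⟨measurable_coe, by rw [measurableEmbedding_coe.map_comap]⟩

lemma measurable_density :
    Measurable fun z : ℍ => (1 / NNReal.mk z.im z.im_pos.le : NNReal) ^ 2 := by
  refine Continuous.measurable (.pow (.div₀ continuous_const ?_ ?_) _)
  · exact continuous_im.subtype_mk _
  · exact fun x => NNReal.ne_iff.mp x.im_ne_zero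

lemma density_smul (z : ℍ) (c : ℂ) :
    (1 / NNReal.mk z.im z.im_pos.le : NNReal) ^ 2 • c = (z.im : ℂ) ^ (-2 : ℤ) * c := by
  rw [NNReal.smul_def, Complex.real_smul]
  simp [zpow_neg]

/-- The factor `y ^ (-2)` is the density of the measure on `ℍ` against Lebesgue measure. The closed
strip replaces the open one because their difference is null. -/
lemma integrableOn_fdo_iff (G : ℍ → ℂ) :
    IntegrableOn G 𝒟ᵒ ↔ IntegrableOn
      (fun p => ((strip p).im : ℂ) ^ (-2 : ℤ) * G (ofComplex (strip p)))
      (Set.Icc (-(1 / 2) : ℝ) (1 / 2) ×ˢ Set.Ici 0) := by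
  have hm : MeasurableSet (𝒟ᵒ : Set ℍ) := ModularGroup.isOpen_fdo.measurableSet
  rw [← integrableOn_congr_set_ae strip_ae_eq, ← strip_preimage_fdo]
  have h1 := measurePreserving_strip.integrableOn_comp_preimage stripEquiv.measurableEmbedding
    (f := fun w => (w.im : ℂ) ^ (-2 : ℤ) * G (ofComplex w)) (s := (↑) '' (𝒟ᵒ : Set ℍ))
  have h2 := measurePreserving_coe.integrableOn_image measurableEmbedding_coe
    (f := fun w => (w.im : ℂ) ^ (-2 : ℤ) * G (ofComplex w)) (s := 𝒟ᵒ)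
  refine Iff.trans ?_ h1.symm
  rw [IntegrableOn, IntegrableOn, Measure.restrict_restrict
    (measurableEmbedding_coe.measurableSet_image.mpr hm),
    Set.inter_eq_self_of_subset_left (Set.image_subset_range _ _)] at h2
  rw [IntegrableOn, IntegrableOn, h2, volume_def, restrict_withDensity hm,
    integrable_withDensity_iff_integrable_smul measurable_density]
  simp only [density_smul, Function.comp_def, ofComplex_apply, coe_im]

lemma integral_fdo_eq (G : ℍ → ℂ) :
    ∫ z in 𝒟ᵒ, G z = ∫ p in Set.Icc (-(1 / 2) : ℝ) (1 / 2) ×ˢ Set.Ici 0,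
      ((strip p).im : ℂ) ^ (-2 : ℤ) * G (ofComplex (strip p)) := by
  have hm : MeasurableSet (𝒟ᵒ : Set ℍ) := ModularGroup.isOpen_fdo.measurableSet
  rw [← setIntegral_congr_set strip_ae_eq, ← strip_preimage_fdo,
    measurePreserving_strip.setIntegral_preimage_emb stripEquiv.measurableEmbedding
      (fun w => (w.im : ℂ) ^ (-2 : ℤ) * G (ofComplex w))]
  have h2 := measurePreserving_coe.setIntegral_image_emb measurableEmbedding_coe
    (fun w => (w.im : ℂ) ^ (-2 : ℤ) * G (ofComplex w)) 𝒟ᵒ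
  rw [Measure.restrict_restrict (measurableEmbedding_coe.measurableSet_image.mpr hm),
    Set.inter_eq_self_of_subset_left (Set.image_subset_range _ _)] at h2
  rw [h2, volume_def, setIntegral_withDensity_eq_setIntegral_smul measurable_density _ hm]
  simp only [density_smul, ofComplex_apply, coe_im]

/-! ### The invariant form: differential, invariance and decay. -/

/-- The coefficient `y ^ n F conj(g)` of the form `y ^ n F conj(g) d(conj z)`, as a function on
`ℂ`. -/
def potential (n : ℤ) (F g : ℍ → ℂ) (w : ℂ) : ℂ :=
  (w.im : ℂ) ^ n * F (ofComplex w) * conj (g (ofComplex w))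

lemma potential_coe (n : ℤ) (F g : ℍ → ℂ) (z : ℍ) :
    potential n F g z = (z.im : ℂ) ^ n * F z * conj (g z) := by
  simp only [potential, ofComplex_apply, coe_im]

/-- `y ^ n F conj(g)` is differentiable, and its Wirtinger derivative is given by `∂_n F`. -/
lemma hasFDerivAt_potential (n : ℤ) {k : ℤ} {F : ℍ → ℂ} (hF : IsRealAnalytic F) (g : CuspForm 𝒮ℒ k) (z : ℍ) :
    ∃ L : ℂ →L[ℝ] ℂ, HasFDerivAt (potential n F g) L z ∧
      L 1 - Complex.I * L Complex.I =
        -Complex.I * ((z.im : ℂ) ^ (-2 : ℤ) * integrand (n + 1) (maass n F) g z) := by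
  have hy : (z.im : ℂ) ≠ 0 := by exact_mod_cast z.im_ne_zero
  -- Under `L ↦ L 1 - I * L I` this factor yields `-I * n * y ^ (n - 1)`, the source of the term `n
  -- * F` in `maass n F`.
  have h1 : HasFDerivAt (fun w : ℂ => (w.im : ℂ) ^ n)
      ((n * (z.im : ℂ) ^ (n - 1)) • (Complex.ofRealCLM.comp Complex.imCLM)) (z : ℂ) := by
    have h := (hasDerivAt_zpow (𝕜 := ℂ) n ((z : ℂ).im : ℂ) (Or.inl hy))
    have h' := (h.hasFDerivAt.restrictScalars ℝ).comp (z : ℂ)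
      (Complex.ofRealCLM.comp Complex.imCLM).hasFDerivAt
    refine h'.congr_fderiv ?_
    ext
    simp [mul_comm]
  have h2 : HasFDerivAt (fun w : ℂ => F (ofComplex w))
      (fderiv ℝ (fun w : ℂ => F (ofComplex w)) z) (z : ℂ) :=
    (hF z z.im_pos).differentiableAt.hasFDerivAt
  obtain ⟨g', hg'⟩ : ∃ g', HasDerivAt (fun w : ℂ => g (ofComplex w)) g' z := by
    have h := (UpperHalfPlane.mdifferentiable_iff.mp (CuspFormClass.holo g)).differentiableAt
      (isOpen_upperHalfPlaneSet.mem_nhds z.im_pos)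
    exact ⟨_, h.hasDerivAt⟩
  -- The derivative of `conj g` is conjugate linear, so it contributes nothing to `L 1 - I * L I`.
  have h3 := Complex.conjCLE.toContinuousLinearMap.hasFDerivAt.comp (z : ℂ)
    (hg'.hasFDerivAt.restrictScalars ℝ)
  have h4 := (h1.mul h2).mul h3
  refine ⟨_, h4, ?_⟩
  have h5 : ((z : ℂ) - conj (z : ℂ)) = 2 * z.im * Complex.I := by
    apply Complex.ext
    · simp
    · simp; ring
  have e1 : (z.im : ℂ) ^ (n + 1) = (z.im : ℂ) ^ n * z.im := zpow_add_one₀ hy n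
  have e2 : (z.im : ℂ) ^ (n - 1) = (z.im : ℂ) ^ n * (z.im : ℂ)⁻¹ := zpow_sub_one₀ hy n
  have e3 : (z.im : ℂ) ^ (-2 : ℤ) = (z.im : ℂ)⁻¹ ^ 2 := by
    rw [zpow_neg, inv_pow]; norm_cast
  simp only [integrand, maass, wirtinger, h5, e1, e2, e3]
  simp [ofComplex_apply]
  field_simp
  ring_nf
  simp
  ring

lemma potential_add_one {r s : ℤ} {F : ℍ → ℂ} (n : ℤ) (hF : IsModular r s F) {k : ℤ}
    (g : CuspForm 𝒮ℒ k) (z : ℍ) : potential n F g ((z : ℂ) + 1) = potential n F g z := by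
  have h1 : ((ModularGroup.T • z : ℍ) : ℂ) = z + 1 := by
    rw [modular_T_smul, coe_vadd, add_comm]; simp
  have h2 : (ModularGroup.T • z : ℍ).im = z.im := by rw [modular_T_smul, vadd_im]
  have h3 : F (ModularGroup.T • z) = F z := by
    rw [hF]; simp [ModularGroup.T]
  have h4 : g (ModularGroup.T • z) = g z := by
    have := SlashInvariantForm.slash_action_eqn'' g
      (γ := (ModularGroup.T : GL (Fin 2) ℝ)) (show _ ∈ 𝒮ℒ from ⟨ModularGroup.T, rfl⟩) z
    refine this.trans ?_
    simp [denom, ModularGroup.coe_T]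
  rw [← h1, potential_coe, potential_coe, h2, h3, h4]

/-- On the unit circle `S` preserves `y`, so the power `n` plays no role. The automorphy factors are
`z ^ r * conj z ^ s` from `F` and `conj z ^ k` from `conj g`; as `z = (conj z)⁻¹`, the total is
`conj z ^ (k + s - r) = conj z ^ 2`. -/
lemma potential_neg_conj {r s : ℤ} {F : ℍ → ℂ} (n : ℤ) (hF : IsModular r s F) {k : ℤ}
    (hk : k = r + 2 - s) (g : CuspForm 𝒮ℒ k) (z : ℍ) (hz : ‖(z : ℂ)‖ = 1) :
    potential n F g (-conj (z : ℂ)) = conj (z : ℂ) ^ 2 * potential n F g z := by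
  have hzz : (z : ℂ) * conj (z : ℂ) = 1 := by
    rw [Complex.mul_conj, Complex.normSq_eq_norm_sq, hz]; simp
  have hz0 : (z : ℂ) ≠ 0 := z.ne_zero
  have hinv : conj (z : ℂ) = (z : ℂ)⁻¹ := eq_inv_of_mul_eq_one_right hzz
  have h1 : ((ModularGroup.S • z : ℍ) : ℂ) = -conj (z : ℂ) := by
    rw [modular_S_smul, hinv, ← inv_neg]
  have h2 : (ModularGroup.S • z : ℍ).im = z.im := by
    rw [← coe_im, h1]; simp
  have h3 : F (ModularGroup.S • z) = (z : ℂ) ^ r * conj (z : ℂ) ^ s * F z := by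
    rw [hF]; simp [ModularGroup.S]
  have h4 : g (ModularGroup.S • z) = (z : ℂ) ^ k * g z := by
    have := SlashInvariantForm.slash_action_eqn'' g
      (γ := (ModularGroup.S : GL (Fin 2) ℝ)) (show _ ∈ 𝒮ℒ from ⟨ModularGroup.S, rfl⟩) z
    refine this.trans ?_
    simp [denom, ModularGroup.coe_S]
  rw [← h1, potential_coe, potential_coe, h2, h3, h4]
  simp only [map_mul, map_zpow₀, hinv, inv_zpow', hk]
  have : (z : ℂ) ^ r * (z : ℂ) ^ (-s) * (z : ℂ) ^ (-(r + 2 - s)) = (z : ℂ)⁻¹ ^ 2 := by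
    rw [← zpow_add₀ hz0, ← zpow_add₀ hz0, inv_pow, ← zpow_natCast, ← zpow_neg]
    congr 1
    push_cast
    ring
  linear_combination ((z.im : ℂ) ^ n * F z * conj (g z)) * this

/-- The exponential decay of the cusp form beats the polynomial growth of `y ^ n F`. -/
lemma potential_small {r s : ℤ} {F : ℍ → ℂ} (n : ℤ) (hF : F ∈ M r s) {k : ℤ}
    (g : CuspForm 𝒮ℒ k) {ε : ℝ} (hε : 0 < ε) :
    ∃ Y : ℝ, ∀ w : ℂ, Y < w.im → ‖potential n F g w‖ ≤ ε := by
  obtain ⟨N, hN⟩ := isBigO_of_mem hF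
  have hg := CuspFormClass.exp_decay_atImInfty (h := 1) g one_pos one_mem_strictPeriods_SL
  have h1 : (fun z : ℍ => potential n F g z) =O[atImInfty]
      fun z : ℍ => z.im ^ n * z.im ^ N * Real.exp (-2 * Real.pi * z.im / 1) := by
    simp only [potential_coe]
    refine (Asymptotics.IsBigO.mul ?_ hN).mul ?_
    · refine Asymptotics.IsBigO.of_norm_left ?_
      simpa [norm_zpow] using (Asymptotics.isBigO_refl (fun z : ℍ => z.im ^ n) atImInfty).norm_left
    · exact Asymptotics.IsBigO.trans (Asymptotics.IsBigO.of_norm_left (by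
        simpa using Asymptotics.isBigO_refl (fun z => ‖g z‖) atImInfty)).of_norm_right hg
  have h2 : Filter.Tendsto (fun t : ℝ => t ^ n * t ^ N * Real.exp (-2 * Real.pi * t / 1))
      Filter.atTop (nhds 0) := by
    refine (tendsto_rpow_mul_exp_neg_mul_atTop_nhds_zero (n + N : ℝ) (2 * Real.pi)
      (by positivity)).congr' ?_
    filter_upwards [Filter.eventually_gt_atTop 0] with t ht
    rw [Real.rpow_add ht, Real.rpow_natCast, Real.rpow_intCast]
    ring_nf
  have h3 := (h1.trans_tendsto (h2.comp Filter.tendsto_comap)).norm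
  rw [norm_zero] at h3
  have h4 := h3.eventually (gt_mem_nhds hε)
  rw [atImInfty, Filter.eventually_comap, Filter.eventually_atTop] at h4
  obtain ⟨Y, hY⟩ := h4
  -- Taking the maximum with `0` ensures that `w` lies in the upper half plane.
  refine ⟨max Y 0, fun w hw => ?_⟩
  exact (hY w.im ((le_max_left _ _).trans hw.le) ⟨w, (le_max_right _ _).trans_lt hw⟩ rfl).le

/-- The pairing of `∂_n F` with holomorphic cusp forms vanishes. -/
lemma pairing_maass_eq_zero {n s : ℤ} {F : ℍ → ℂ} (hF : F ∈ M n s) {k : ℤ} (hk : k = n + 2 - s)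
    (g : CuspForm 𝒮ℒ k) (hc : Continuous (maass n F))
    (hi : IntegrableOn (integrand (n + 1) (maass n F) g) 𝒟ᵒ) :
    pairing (n + 1) (maass n F) g = 0 := by
  choose L hL hLK using hasFDerivAt_potential n hF.1 g
  -- Outside the upper half plane `ofComplex` takes a default value; `H'` is only used where `0 <
  -- w.im`.
  let H' : ℂ → ℂ →L[ℝ] ℂ := fun w => L (ofComplex w)
  have hK : ∀ w : ℂ, 0 < w.im → H' w 1 - Complex.I * H' w Complex.I = -Complex.I *
      ((w.im : ℂ) ^ (-2 : ℤ) * integrand (n + 1) (maass n F) g (ofComplex w)) := by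
    intro w hw
    have := hLK (ofComplex w)
    have hw' : ((ofComplex w : ℍ) : ℂ) = w := by rw [ofComplex_apply_of_im_pos hw]
    rwa [← coe_im, hw'] at this
  have hm : MeasurableSet (Set.Icc (-(1 / 2) : ℝ) (1 / 2) ×ˢ Set.Ici (0 : ℝ)) :=
    measurableSet_Icc.prod measurableSet_Ici
  have hKs : ∀ p ∈ Set.Icc (-(1 / 2) : ℝ) (1 / 2) ×ˢ Set.Ici (0 : ℝ),
      H' (strip p) 1 - Complex.I * H' (strip p) Complex.I = -Complex.I *
      (((strip p).im : ℂ) ^ (-2 : ℤ) *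
        integrand (n + 1) (maass n F) g (ofComplex (strip p))) :=
    fun p hp => hK _ (strip_im_pos hp.1 hp.2)
  have hgc : Continuous g := (CuspFormClass.holo g).continuous
  have hic : Continuous (integrand (n + 1) (maass n F) g) := by
    refine (hc.mul (Complex.continuous_conj.comp hgc)).mul (Continuous.zpow₀ ?_ _ ?_)
    · exact Complex.continuous_ofReal.comp continuous_im
    · intro z; left; exact_mod_cast z.im_ne_zero
  have key := integral_strip_eq_zero (H := potential n F g) (H' := H')
    (fun w hw => by
      have := hL (ofComplex w)
      have hw' : ((ofComplex w : ℍ) : ℂ) = w := by rw [ofComplex_apply_of_im_pos hw]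
      rwa [hw'] at this)
    (by
      refine ContinuousOn.congr (continuousOn_const.mul (ContinuousOn.mul ?_ ?_)) hK
      · refine ContinuousOn.zpow₀ (by fun_prop) _ fun w hw => Or.inl ?_
        exact_mod_cast ne_of_gt hw
      · refine hic.comp_continuousOn fun w hw => ?_
        exact (contMDiffAt_ofComplex (n := 0) hw).continuousAt.continuousWithinAt)
    (fun w hw => potential_add_one n hF.2.1 g ⟨w, hw⟩)
    (fun w hw h => potential_neg_conj n hF.2.1 hk g ⟨w, hw⟩ h)
    (fun ε hε => potential_small n hF g hε)
    (IntegrableOn.congr_fun (((integrableOn_fdo_iff _).mp hi).const_mul (-Complex.I))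
      (fun p hp => (hKs p hp).symm) hm)
  rw [setIntegral_congr_fun hm hKs, integral_const_mul, ← integral_fdo_eq] at key
  exact (mul_eq_zero.mp key).resolve_left (neg_ne_zero.mpr Complex.I_ne_zero)

/-! ### Conclusion. -/

/-- The index `(r - 1 + 1, s + 1 - 1)` equals `(r, s)` only propositionally; comparing in the
ambient space `V` avoids transport between submodules. -/
lemma directSum_of_apply_of_eq {ι : Type*} [DecidableEq ι] {V : Type*} [AddCommGroup V] [Module ℂ V]
    (W : ι → Submodule ℂ V) {i j : ι} (h : j = i) (x : W i) :
    (DirectSum.of (fun i => W i) i x j : V) = x := by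
  subst h
  rw [DirectSum.of_eq_same]

end RealAnalyticModular

end
open RealAnalyticModular in
theorem mainTheorem1 (r s : ℤ) (f : M r s) (hf : HasPrimitive f) :
    (∀ g : CuspForm 𝒮ℒ (r - s),
      IntegrableOn (integrand r f g) 𝒟ᵒ ∧ pairing r f g = 0) ∧
    holomorphicProjection r s f = 0 := by
  have hz : ∀ g : CuspForm 𝒮ℒ (r - s), pairing r f g = 0 := by
    intro g
    obtain ⟨F, hF⟩ := hf
    have h1 := hF (r - 1) (s + 1)
    have h0 : (F (r - 1, s + 1) : ℍ → ℂ) ∈ M (r - 1) (s + 1) := (F (r - 1, s + 1)).2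
    have h2 : maass (r - 1) (F (r - 1, s + 1) : ℍ → ℂ) = f :=
      h1.trans (directSum_of_apply_of_eq (fun p : ℤ × ℤ => M p.1 p.2)
        (i := (r, s)) (j := (r - 1 + 1, s + 1 - 1)) (by simp) f)
    generalize (F (r - 1, s + 1) : ℍ → ℂ) = φ at h0 h2
    -- Continuity and integrability of `∂F` are inherited from `f ∈ M r s`, so it is not needed that
    -- `∂` preserves `M`.
    have h3 := pairing_maass_eq_zero h0 (k := r - s) (by ring) g
      (by rw [h2]; exact continuous_of_mem f.2)
      (by rw [h2]; exact integrableOn_integrand _ f.2 g)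
    rwa [h2, sub_add_cancel] at h3
  refine ⟨fun g => ⟨integrableOn_integrand r f.2 g, hz g⟩, ?_⟩
  -- The projection is the pairing functional followed by the inverse Petersson isomorphism, so it
  -- suffices that the functional vanishes.
  have h : pairingFunctional r s f = 0 := by
    ext g
    exact hz g
  rw [holomorphicProjection, LinearMap.comp_apply, h, map_zero]
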